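/- Let $U\subseteq\mathbb{R}^d$ be open, let $f:U\to\mathbb{R}$ be twice continuously differentiable, and let $\Omega\subseteq U$ be convex. Let $L\ge 0$ be such that $\nabla f$ is $L$-Lipschitz on $\Omega$ with respect to the Euclidean norm (for instance the best such constant, if it is finite), and let $\alpha\in\mathbb{R}$ satisfy $\alpha L\in(0,2)$. Put $g(x)=x-\alpha\nabla f(x)$ and assume that $\Omega$ is forward invariant, i.e. $g(\Omega)\subseteq\Omega$. A point $x^*\in U$ with $\nabla f(x^*)=0$ is called a saddle point if every neighbourhood of $x^*$ contains points $x,y$ with $f(x)<f(x^*)<f(y)$, and a strict saddle if $\nabla^2 f(x^*)$ has at least one negative eigenvalue. Assume that the set $$\{x\in\Omega \;:\; \alpha^{-1}\in\sigma(\nabla^2 f(x))\}$$ has Lebesgue measure zero and contains no saddle point of $f$. Then the set of all initial points $x^0\in\Omega$ for which the gradient descent sequence $x^{n+1}=g(x^n)$ converges to a strict saddle $x^*\in U$ of $f$ has Lebesgue measure zero. (In particular, if $\Omega$ has finite positive measure, then gradient descent started at a uniformly random point of $\Omega$ converges to a strict saddle with probability zero.) -/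

import Mathlib

open MeasureTheory Filter Topology

noncomputable section

/-- The Hessian `∇²f(x)`, as the linear operator on `ℝ^d` that is the derivative of `∇f` at `x`. -/
def hessianOp {d : ℕ} (f : EuclideanSpace ℝ (Fin d) → ℝ) (x : EuclideanSpace ℝ (Fin d)) :
    EuclideanSpace ℝ (Fin d) →L[ℝ] EuclideanSpace ℝ (Fin d) :=
  fderiv ℝ (gradient f) x

/-- The gradient descent map `g(x) = x - α ∇f(x)`. -/
def gdMap {d : ℕ} (f : EuclideanSpace ℝ (Fin d) → ℝ) (α : ℝ) (x : EuclideanSpace ℝ (Fin d)) :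
    EuclideanSpace ℝ (Fin d) :=
  x - α • gradient f x

/-- A saddle point: a critical point at which `f` has neither a local minimum nor a local maximum,
that is, every neighbourhood contains points with smaller and points with larger values.
(With non-strict inequalities, `y = z = x` would make every critical point a saddle point.) -/
def IsSaddlePoint {d : ℕ} (f : EuclideanSpace ℝ (Fin d) → ℝ) (x : EuclideanSpace ℝ (Fin d)) :
    Prop :=
  gradient f x = 0 ∧ ∀ V ∈ 𝓝 x, ∃ y ∈ V, ∃ z ∈ V, f y < f x ∧ f x < f z

/-- A strict saddle point: a critical point at which the Hessian has a negative eigenvalue.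
Local maxima are allowed. -/
def IsStrictSaddle {d : ℕ} (f : EuclideanSpace ℝ (Fin d) → ℝ) (x : EuclideanSpace ℝ (Fin d)) :
    Prop :=
  gradient f x = 0 ∧
    ∃ μ : ℝ, μ < 0 ∧ Module.End.HasEigenvalue
      (hessianOp f x : EuclideanSpace ℝ (Fin d) →ₗ[ℝ] EuclideanSpace ℝ (Fin d)) μ

/-- The degenerate set `{x ∈ Ω | α⁻¹ ∈ σ(∇²f(x))}`. -/
def degenerateSet {d : ℕ} (f : EuclideanSpace ℝ (Fin d) → ℝ) (α : ℝ)
    (Ω : Set (EuclideanSpace ℝ (Fin d))) : Set (EuclideanSpace ℝ (Fin d)) :=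
  {x | x ∈ Ω ∧ α⁻¹ ∈ spectrum ℝ (hessianOp f x)}

end

/-!
Gradient descent `g = id - α ∇f` almost surely avoids the strict saddles of `f`. Two facts carry the
proof; neither uses the existence of a stable manifold.

*Trapped orbits form a null set.* Let `p` be a strict saddle in the closure of `Ω`, with Hessian
`H`, and let `A = id - α H` be the derivative of `g` at `p`. Choose `c > 0` such that `-c` is not an
eigenvalue of `H` but some eigenvalue lies below `-c`, and put `B = H + c`, `Q v = -⟪B v, v⟫`.
On an eigenvector of eigenvalue `h`, the form `Q` is multiplied by `(1 - α h) ^ 2` under `A`. Since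
`‖H‖ ≤ L` and `α L < 2`, this factor exceeds `κ = (1 + α c) ^ 2` if `h < -c`, where `Q` is positive,
and is smaller than `κ` if `h > -c`, where `Q` is negative, so
`Q (A v) ≥ κ Q v + δ ‖v‖ ^ 2` with `κ > 1` and `δ > 0` (`neg_inner_step_ge`). The margin `δ` absorbs
the nonlinearity of `g` near `p`, giving `Q (g x - g y) ≥ κ Q (x - y)` there. If the orbits of `x`
and `y` both stay near `p`, then `Q` of their difference is bounded, hence `Q (x - y) ≤ 0`.
Therefore a line in the direction of an eigenvector `e` of negative eigenvalue `< -c`, for which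
`Q e > 0`, contains at most one point whose orbit stays near `p`, and by Fubini the set of all such
points is null (`exists_nhds_addHaar_trapped_eq_zero`). The derivative `A` may be singular here.

*Preimages of null sets are null.* Off the degenerate set, which is null, the derivative of `g` is
invertible, so `g ⁻¹' N ∩ Ω` is null whenever `N` is (`addHaar_inter_preimage_eq_zero`).

An orbit that converges to a strict saddle is eventually trapped near one of countably many strict
saddles, so its starting point lies in a countable union of iterated preimages of null sets
(`measure_setOf_tendsto_eq_zero`).
-/

open scoped NNReal ENNReal RealInnerProductSpace

/-! ### The expanding quadratic form -/

section LinearAlgebra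

variable {E : Type*} [NormedAddCommGroup E] [InnerProductSpace ℝ E]

/-- The form `v ↦ -⟪(H + c) v, v⟫` grows at least by the factor `(1 + α c) ^ 2` under
`id - α H`, with a surplus that is nonnegative for `0 ≤ α` and `α L ≤ 2 + α c`. The identity behind
it, with `B = H + c`, is
`B (1 + α c) ^ 2 - B (1 - α H) ^ 2 = α B ^ 2 (2 + α c - α H)`. -/
theorem neg_inner_step_ge (H : E →L[ℝ] E) (hH : ∀ u v, ⟪H u, v⟫ = ⟪u, H v⟫) {α c L : ℝ}
    (hHL : ‖H‖ ≤ L) (v : E) :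
    (1 + α * c) ^ 2 * -⟪(H + c • ContinuousLinearMap.id ℝ E) v, v⟫
        + α * (2 + α * c - α * L) * ‖(H + c • ContinuousLinearMap.id ℝ E) v‖ ^ 2 ≤
      -⟪(H + c • ContinuousLinearMap.id ℝ E) (v - α • H v), v - α • H v⟫ := by
  set B := H + c • ContinuousLinearMap.id ℝ E with hB
  have hsymm : ∀ u v, ⟪B u, v⟫ = ⟪u, B v⟫ := fun u v => by
    simp [hB, inner_add_left, inner_add_right, hH, inner_smul_left, inner_smul_right]
  have hstep : v - α • H v = (1 + α * c) • v - α • B v := by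
    simp only [hB, add_apply, smul_apply, ContinuousLinearMap.id_apply]
    module
  have hw : ⟪B (B v), B v⟫ ≤ (L + c) * ‖B v‖ ^ 2 := by
    have h1 : ⟪H (B v), B v⟫ ≤ L * ‖B v‖ ^ 2 :=
      calc ⟪H (B v), B v⟫ ≤ ‖H (B v)‖ * ‖B v‖ := real_inner_le_norm _ _
        _ ≤ (L * ‖B v‖) * ‖B v‖ := by
          gcongr
          exact (H.le_opNorm _).trans (by gcongr)
        _ = _ := by ring
    have h2 : ⟪B (B v), B v⟫ = ⟪H (B v), B v⟫ + c * ‖B v‖ ^ 2 := by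
      rw [show B (B v) = H (B v) + c • B v from rfl, inner_add_left, real_inner_smul_left,
        real_inner_self_eq_norm_sq]
    linarith
  have hexp : ⟪B (v - α • H v), v - α • H v⟫ = (1 + α * c) ^ 2 * ⟪B v, v⟫
      - 2 * α * (1 + α * c) * ‖B v‖ ^ 2 + α ^ 2 * ⟪B (B v), B v⟫ := by
    rw [hstep, map_sub, map_smul, map_smul]
    simp only [inner_sub_left, inner_sub_right, real_inner_smul_left, real_inner_smul_right,
      hsymm (B v) v, real_inner_self_eq_norm_sq]
    ring
  rw [hexp]
  nlinarith [mul_le_mul_of_nonneg_left hw (sq_nonneg α)]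

/-- The shift makes `H + c` bounded below, which turns the surplus `‖(H + c) v‖ ^ 2` of
`neg_inner_step_ge` into a multiple of `‖v‖ ^ 2`. It exists because `H` has only finitely many
eigenvalues. -/
theorem exists_shift_antilipschitz [FiniteDimensional ℝ E] (H : E →L[ℝ] E) {m : ℝ} (hm : m < 0) :
    ∃ c, 0 < c ∧ c < -m ∧ ∃ K : ℝ≥0, 0 < K ∧
      AntilipschitzWith K (H + c • ContinuousLinearMap.id ℝ E) := by
  have hfin := Module.End.finite_hasEigenvalue (f := (H : E →ₗ[ℝ] E))
  obtain ⟨t, ⟨ht0, ht1⟩, ht⟩ := ((Set.Ioo_infinite hm).sdiff hfin).nonempty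
  refine ⟨-t, by linarith, by linarith, ?_⟩
  have hinj : Function.Injective
      ((H + (-t) • ContinuousLinearMap.id ℝ E : E →L[ℝ] E) : E →ₗ[ℝ] E) := by
    rw [← LinearMap.ker_eq_bot, LinearMap.ker_eq_bot']
    intro v hv
    by_contra hv0
    refine ht (Module.End.hasEigenvalue_of_hasEigenvector (x := v) ⟨?_, hv0⟩)
    rw [Module.End.mem_eigenspace_iff]
    simp only [ContinuousLinearMap.coe_coe, add_apply, neg_smul] at hv ⊢
    exact add_neg_eq_zero.mp hv
  exact (LinearMap.injective_iff_antilipschitz _).mp hinj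

end LinearAlgebra

/-! ### Null sets of trapped points and of preimages -/

section NullSets

variable {E : Type*} [NormedAddCommGroup E] [InnerProductSpace ℝ E] [FiniteDimensional ℝ E]
  [MeasurableSpace E] [BorelSpace E] (ν : Measure E) [ν.IsAddHaarMeasure]

/-- Two points of `s` on a common line in direction `e` would differ by a multiple `t • e`, with
`⟪B (t • e), t • e⟫ < 0`. So each such line meets `s` at most once, and Fubini applies. -/
theorem addHaar_eq_zero_of_forall_inner_sub_nonneg (B : E →L[ℝ] E) {e : E} (he : ⟪B e, e⟫ < 0)
    {s : Set E} (hs : ∀ x ∈ s, ∀ y ∈ s, 0 ≤ ⟪B (x - y), x - y⟫) : ν s = 0 := by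
  -- The condition is closed, so `s` may be replaced by its closure, which is measurable.
  have hcl : ∀ x ∈ closure s, ∀ y ∈ closure s, 0 ≤ ⟪B (x - y), x - y⟫ := by
    intro x hx y hy
    have hclosed : IsClosed {p : E × E | 0 ≤ ⟪B (p.1 - p.2), p.1 - p.2⟫} :=
      isClosed_le continuous_const (by fun_prop)
    have hsub : s ×ˢ s ⊆ {p : E × E | 0 ≤ ⟪B (p.1 - p.2), p.1 - p.2⟫} :=
      fun p hp => hs _ hp.1 _ hp.2
    have hxy : (x, y) ∈ closure (s ×ˢ s) := by
      rw [closure_prod_eq]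
      exact ⟨hx, hy⟩
    exact closure_minimal hsub hclosed hxy
  have hline : ∀ y : E, ∀ᵐ r : ℝ, y + LinearMap.toSpanSingleton ℝ E e r ∈ (closure s)ᶜ := by
    intro y
    rw [ae_iff]
    refine Set.Subsingleton.measure_zero (fun a ha b hb => ?_) _
    simp only [Set.mem_compl_iff, not_not, Set.mem_ofPred_eq,
      LinearMap.toSpanSingleton_apply] at ha hb
    have h := hcl _ ha _ hb
    rw [show y + a • e - (y + b • e) = (a - b) • e by module, map_smul, real_inner_smul_left,
      real_inner_smul_right, ← mul_assoc] at h
    by_contra hab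
    have : 0 < (a - b) * (a - b) := mul_self_pos.mpr (sub_ne_zero.mpr hab)
    nlinarith
  have hae := ae_mem_of_ae_add_linearMap_mem (LinearMap.toSpanSingleton ℝ E e) volume ν
    isClosed_closure.measurableSet.compl hline
  exact measure_mono_null subset_closure (by simpa [ae_iff] using hae)

/-- A substitute for the center-stable manifold theorem: near a point where the derivative is
`id - α H`, with `H` symmetric and possessing a negative eigenvalue, the points whose whole forward
orbit stays nearby form a null set. The bound `α ‖H‖ < 2` keeps the eigenvalues of `id - α H` that
come from nonnegative eigenvalues of `H` in `(-1, 1]`. -/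
theorem exists_nhds_addHaar_trapped_eq_zero {g : E → E} {p : E} (H : E →L[ℝ] E)
    (hH : ∀ u v, ⟪H u, v⟫ = ⟪u, H v⟫) {α L : ℝ} (hα : 0 < α) (hHL : ‖H‖ ≤ L) (hαL : α * L < 2)
    {m : ℝ} (hm : m < 0) (heig : Module.End.HasEigenvalue (H : E →ₗ[ℝ] E) m)
    (hg : HasStrictFDerivAt g (ContinuousLinearMap.id ℝ E - α • H) p) :
    ∃ s ∈ 𝓝 p, ν {x | ∀ n : ℕ, g^[n] x ∈ s} = 0 := by
  obtain ⟨c, hc0, hcm, K, hK, hanti⟩ := exists_shift_antilipschitz H hm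
  set B := H + c • ContinuousLinearMap.id ℝ E with hB
  set A := ContinuousLinearMap.id ℝ E - α • H with hA
  have hsymm : ∀ u v, ⟪B u, v⟫ = ⟪u, B v⟫ := fun u v => by
    simp [hB, inner_add_left, inner_add_right, hH, inner_smul_left, inner_smul_right]
  obtain ⟨e, he⟩ := heig.exists_hasEigenvector
  have heB : ⟪B e, e⟫ < 0 := by
    have h1 : H e = m • e := he.apply_eq_smul
    have h2 : 0 < ‖e‖ := norm_pos_iff.mpr he.2
    simp only [hB, add_apply, smul_apply,
      ContinuousLinearMap.id_apply, h1, ← add_smul, real_inner_smul_left,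
      real_inner_self_eq_norm_sq]
    exact mul_neg_of_neg_of_pos (by linarith) (by positivity)
  set δ : ℝ := α * (2 + α * c - α * L) * ((K : ℝ)⁻¹) ^ 2 with hδ
  have hcoef : 0 < α * (2 + α * c - α * L) := mul_pos hα (by nlinarith [mul_pos hα hc0])
  have hδ0 : 0 < δ := by have : (0 : ℝ) < K := hK; positivity
  have hlin : ∀ v, (1 + α * c) ^ 2 * -⟪B v, v⟫ + δ * ‖v‖ ^ 2 ≤ -⟪B (A v), A v⟫ := by
    intro v
    have h1 := neg_inner_step_ge H hH (α := α) (c := c) hHL v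
    have h2 : (K : ℝ)⁻¹ * ‖v‖ ≤ ‖B v‖ := by
      have h3 : ‖v‖ ≤ K * ‖B v‖ := by
        simpa using hanti.le_mul_dist v 0
      rw [inv_mul_le_iff₀ (by exact_mod_cast hK)]
      exact h3
    have h4 : δ * ‖v‖ ^ 2 ≤ α * (2 + α * c - α * L) * ‖B v‖ ^ 2 := by
      rw [hδ, mul_assoc, ← mul_pow]
      gcongr
    have h5 : A v = v - α • H v := by simp [hA]
    rw [h5]
    linarith
  -- If `‖r‖ ≤ ε ‖v‖` with `ε ≤ 1`, replacing `A v` by `A v + r` changes the form by at most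
  -- `ε * C * ‖v‖ ^ 2`, which the surplus `δ * ‖v‖ ^ 2` absorbs.
  set C : ℝ := ‖B‖ * (2 * ‖A‖ + 1) with hC
  have hC0 : 0 ≤ C := by positivity
  obtain ⟨ε, hε0, hε1, hεδ⟩ : ∃ ε : ℝ≥0, 0 < ε ∧ (ε : ℝ) ≤ 1 ∧ ε * C ≤ δ := by
    have hpos : 0 < min 1 (δ / (C + 1)) := by positivity
    refine ⟨⟨_, hpos.le⟩, hpos, min_le_left _ _, ?_⟩
    calc min 1 (δ / (C + 1)) * C ≤ δ / (C + 1) * (C + 1) := by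
          gcongr
          · exact min_le_right _ _
          · linarith
      _ = δ := by field_simp
  obtain ⟨s, hs, happ⟩ := hg.approximates_deriv_on_nhds (Or.inr hε0)
  have hstep : ∀ x ∈ s, ∀ y ∈ s,
      (1 + α * c) ^ 2 * -⟪B (x - y), x - y⟫ ≤ -⟪B (g x - g y), g x - g y⟫ := by
    intro x hx y hy
    set v := x - y
    set r := g x - g y - A v with hr
    have hrn : ‖r‖ ≤ ε * ‖v‖ := happ x hx y hy
    have hgr : g x - g y = A v + r := by rw [hr]; abel
    have hexp : ⟪B (A v + r), A v + r⟫ = ⟪B (A v), A v⟫ + 2 * ⟪B r, A v⟫ + ⟪B r, r⟫ := by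
      rw [map_add, inner_add_left, inner_add_right, inner_add_right, hsymm (A v) r,
        real_inner_comm (B r) (A v)]
      ring
    have h1 : ⟪B r, A v⟫ ≤ ‖B‖ * (ε * ‖v‖) * (‖A‖ * ‖v‖) :=
      (real_inner_le_norm _ _).trans (mul_le_mul ((B.le_opNorm _).trans (by gcongr))
        (A.le_opNorm _) (norm_nonneg _) (by positivity))
    have h2 : ⟪B r, r⟫ ≤ ‖B‖ * (ε * ‖v‖) * (1 * ‖v‖) :=
      (real_inner_le_norm _ _).trans (mul_le_mul ((B.le_opNorm _).trans (by gcongr))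
        (hrn.trans (by gcongr)) (norm_nonneg _) (by positivity))
    have h3 : ε * C * ‖v‖ ^ 2 ≤ δ * ‖v‖ ^ 2 := by gcongr
    have h4 := hlin v
    rw [hgr, hexp]
    have h5 : 2 * (‖B‖ * (ε * ‖v‖) * (‖A‖ * ‖v‖)) + ‖B‖ * (ε * ‖v‖) * (1 * ‖v‖)
        = ε * C * ‖v‖ ^ 2 := by rw [hC]; ring
    linarith
  -- The ball keeps the form bounded along trapped orbits.
  refine ⟨s ∩ Metric.ball p 1, Filter.inter_mem hs (Metric.ball_mem_nhds p one_pos), ?_⟩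
  refine addHaar_eq_zero_of_forall_inner_sub_nonneg ν B heB fun x hx y hy => ?_
  by_contra! hneg
  have hgrow : ∀ n : ℕ, ((1 + α * c) ^ 2) ^ n * -⟪B (x - y), x - y⟫
      ≤ -⟪B (g^[n] x - g^[n] y), g^[n] x - g^[n] y⟫ := by
    intro n
    induction n with
    | zero => simp
    | succ n ih =>
      rw [Function.iterate_succ_apply', Function.iterate_succ_apply', pow_succ', mul_assoc]
      exact (mul_le_mul_of_nonneg_left ih (by positivity)).trans
        (hstep _ (hx n).1 _ (hy n).1)
  have hbdd : ∀ n : ℕ, -⟪B (g^[n] x - g^[n] y), g^[n] x - g^[n] y⟫ ≤ ‖B‖ * 2 * 2 := by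
    intro n
    have hd : ‖g^[n] x - g^[n] y‖ ≤ 2 := by
      rw [← dist_eq_norm]
      have h1 : dist (g^[n] x) p < 1 := (hx n).2
      have h2 : dist (g^[n] y) p < 1 := (hy n).2
      linarith [dist_triangle_right (g^[n] x) (g^[n] y) p]
    rw [← inner_neg_right]
    refine (real_inner_le_norm _ _).trans ?_
    rw [norm_neg]
    exact mul_le_mul ((B.le_opNorm _).trans (by gcongr)) hd (norm_nonneg _) (by positivity)
  have hone : 1 < (1 + α * c) ^ 2 := one_lt_pow₀ (by nlinarith [mul_pos hα hc0]) two_ne_zero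
  have htop : Tendsto (fun n : ℕ => ((1 + α * c) ^ 2) ^ n * -⟪B (x - y), x - y⟫) atTop atTop :=
    (tendsto_pow_atTop_atTop_of_one_lt hone).atTop_mul_const (by linarith)
  obtain ⟨n, hn⟩ := (htop.eventually_gt_atTop (‖B‖ * 2 * 2)).exists
  linarith [hgrow n, hbdd n]

theorem exists_nhds_addHaar_inter_preimage_eq_zero {g : E → E} {A : E →L[ℝ] E} {x : E}
    (hg : HasStrictFDerivAt g A x) (hA : A.det ≠ 0) :
    ∃ s ∈ 𝓝 x, ∀ N : Set E, ν N = 0 → ν (s ∩ g ⁻¹' N) = 0 := by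
  obtain ⟨m, hm0, hm⟩ : ∃ m : ℝ≥0, 0 < m ∧ (m : ℝ≥0∞) < ENNReal.ofReal |A.det| := by
    obtain ⟨m, hm0, hm⟩ := ENNReal.lt_iff_exists_nnreal_btwn.mp
      (ENNReal.ofReal_pos.mpr (abs_pos.mpr hA))
    exact ⟨m, by exact_mod_cast hm0, hm⟩
  obtain ⟨δ, hδ, hδ0⟩ :=
    ((mul_le_addHaar_image_of_lt_det ν A hm).and self_mem_nhdsWithin).exists
  obtain ⟨s, hs, happ⟩ := hg.approximates_deriv_on_nhds (Or.inr hδ0)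
  refine ⟨s, hs, fun N hN => ?_⟩
  have h1 := hδ (s ∩ g ⁻¹' N) g (happ.mono_set Set.inter_subset_left)
  have h2 : ν (g '' (s ∩ g ⁻¹' N)) = 0 :=
    measure_mono_null
      ((Set.image_mono Set.inter_subset_right).trans (Set.image_preimage_subset g N)) hN
  rw [h2, nonpos_iff_eq_zero, mul_eq_zero] at h1
  exact h1.resolve_left (by exact_mod_cast hm0.ne')

theorem addHaar_inter_preimage_eq_zero {g : E → E} {g' : E → E →L[ℝ] E} {s : Set E}
    (hg : ∀ x ∈ s, HasStrictFDerivAt g (g' x) x) (hdet : ν {x ∈ s | (g' x).det = 0} = 0)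
    {N : Set E} (hN : ν N = 0) : ν (s ∩ g ⁻¹' N) = 0 := by
  choose! t ht htN using fun x (hx : x ∈ {x ∈ s | (g' x).det ≠ 0}) =>
    exists_nhds_addHaar_inter_preimage_eq_zero ν (hg x hx.1) hx.2
  obtain ⟨u, hu, huc, hcov⟩ := TopologicalSpace.countable_cover_nhdsWithin
    fun x hx => mem_nhdsWithin_of_mem_nhds (ht x hx)
  refine measure_mono_null (t := {x ∈ s | (g' x).det = 0} ∪ ⋃ x ∈ u, t x ∩ g ⁻¹' N) ?_
    (measure_union_null hdet
      ((measure_biUnion_null_iff huc).mpr fun x hx => htN x (hu hx) N hN))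
  rintro x ⟨hx, hxN⟩
  by_cases h : (g' x).det = 0
  · exact Or.inl ⟨hx, h⟩
  · obtain ⟨y, hy, hxy⟩ := Set.mem_iUnion₂.mp (hcov ⟨hx, h⟩)
    exact Or.inr (Set.mem_iUnion₂.mpr ⟨y, hy, hxy, hxN⟩)

end NullSets

/-! ### Convergent orbits -/

section Orbits

theorem measure_inter_iterate_preimage_eq_zero {X : Type*} [MeasurableSpace X] {κ : Measure X}
    {g : X → X} {s : Set X} (hmaps : Set.MapsTo g s s)
    (hpre : ∀ N, κ N = 0 → κ (s ∩ g ⁻¹' N) = 0) {N : Set X} (hN : κ N = 0) (n : ℕ) :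
    κ (s ∩ g^[n] ⁻¹' N) = 0 := by
  induction n with
  | zero => exact measure_mono_null Set.inter_subset_right hN
  | succ n ih =>
    refine measure_mono_null ?_ (hpre _ ih)
    rintro x ⟨hx, hxN⟩
    exact ⟨hx, hmaps hx, hxN⟩

/-- Countably many of the neighbourhoods `t` suffice to cover `P`, and an orbit converging to a point
of `P` eventually stays in one of these. -/
theorem measure_setOf_tendsto_eq_zero {X : Type*} [TopologicalSpace X]
    [SecondCountableTopology X] [MeasurableSpace X] {κ : Measure X} {g : X → X} {s P : Set X}
    (hmaps : Set.MapsTo g s s)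
    (hpre : ∀ N, κ N = 0 → κ (s ∩ g ⁻¹' N) = 0)
    (htrap : ∀ p ∈ P, ∃ t ∈ 𝓝 p, κ {x | ∀ n : ℕ, g^[n] x ∈ t} = 0) :
    κ {x | x ∈ s ∧ ∃ p ∈ P, Tendsto (fun n : ℕ => g^[n] x) atTop (𝓝 p)} = 0 := by
  choose! t ht htn using htrap
  obtain ⟨u, hu, huc, hcov⟩ := TopologicalSpace.countable_cover_nhdsWithin
    fun p hp => mem_nhdsWithin_of_mem_nhds (interior_mem_nhds.mpr (ht p hp))
  refine measure_mono_null
    (t := ⋃ q ∈ u, ⋃ k : ℕ, s ∩ g^[k] ⁻¹' {x | ∀ n : ℕ, g^[n] x ∈ t q}) ?_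
    ((measure_biUnion_null_iff huc).mpr fun q hq => measure_iUnion_null fun k =>
      measure_inter_iterate_preimage_eq_zero hmaps hpre (htn q (hu hq)) k)
  rintro x ⟨hx, p, hp, hlim⟩
  obtain ⟨q, hq, hpq⟩ := Set.mem_iUnion₂.mp (hcov hp)
  obtain ⟨k, hk⟩ := eventually_atTop.mp (hlim.eventually (mem_interior_iff_mem_nhds.mp hpq))
  refine Set.mem_iUnion₂.mpr ⟨q, hq, Set.mem_iUnion.mpr ⟨k, hx, fun n => ?_⟩⟩
  rw [← Function.iterate_add_apply]
  exact hk _ (Nat.le_add_left k n)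

end Orbits

/-! ### The gradient descent map and the Hessian -/

section GradientDescent

variable {d : ℕ} {f : EuclideanSpace ℝ (Fin d) → ℝ}
  {x : EuclideanSpace ℝ (Fin d)}

theorem contDiffAt_gradient (hf : ContDiffAt ℝ 2 f x) : ContDiffAt ℝ 1 (gradient f) x :=
  (InnerProductSpace.toDual ℝ (EuclideanSpace ℝ (Fin d))).symm.contDiff.contDiffAt.comp x
    (hf.fderiv_right (m := 1) (by norm_num))

theorem hasStrictFDerivAt_gdMap (hf : ContDiffAt ℝ 2 f x) (α : ℝ) :
    HasStrictFDerivAt (gdMap f α) (ContinuousLinearMap.id ℝ _ - α • hessianOp f x) x :=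
  (hasStrictFDerivAt_id x).sub
    (((contDiffAt_gradient hf).hasStrictFDerivAt one_ne_zero).const_smul α)

theorem inner_hessianOp_left (hf : ContDiffAt ℝ 2 f x) (u v : EuclideanSpace ℝ (Fin d)) :
    ⟪hessianOp f x u, v⟫ = fderiv ℝ (fderiv ℝ f) x u v := by
  have hd : DifferentiableAt ℝ (gradient f) x :=
    (contDiffAt_gradient hf).differentiableAt one_ne_zero
  let D := (InnerProductSpace.toDual ℝ (EuclideanSpace ℝ (Fin d))).toContinuousLinearEquiv
  have h := D.toContinuousLinearMap.hasFDerivAt.comp x hd.hasFDerivAt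
  have hfun : fderiv ℝ f
      = InnerProductSpace.toDual ℝ (EuclideanSpace ℝ (Fin d)) ∘ gradient f :=
    toDual_comp_gradient.symm
  rw [hfun]
  exact (congrArg (fun T => T u v) h.fderiv).symm

theorem hessianOp_symmetric (hf : ContDiffAt ℝ 2 f x) (u v : EuclideanSpace ℝ (Fin d)) :
    ⟪hessianOp f x u, v⟫ = ⟪u, hessianOp f x v⟫ := by
  rw [real_inner_comm (hessianOp f x v) u, inner_hessianOp_left hf, inner_hessianOp_left hf]
  exact hf.isSymmSndFDerivAt (by simp) u v

theorem continuousAt_hessianOp (hf : ContDiffAt ℝ 2 f x) : ContinuousAt (hessianOp f) x :=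
  ((contDiffAt_gradient hf).fderiv_right (m := 0) (by norm_num)).continuousAt

/-- The Lipschitz constant bounds the Hessian on the interior of `s`, hence by continuity on its
closure; limits of gradient descent need not lie in `s` itself. -/
theorem norm_hessianOp_le_of_mem_closure {s : Set (EuclideanSpace ℝ (Fin d))} {L : ℝ≥0}
    (hL : LipschitzOnWith L (gradient f) s) (hf : ContDiffAt ℝ 2 f x)
    (hx : x ∈ closure (interior s)) : ‖hessianOp f x‖ ≤ L := by
  have : (𝓝[interior s] x).NeBot := mem_closure_iff_nhdsWithin_neBot.mp hx
  refine le_of_tendsto (x := 𝓝[interior s] x)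
    ((continuousAt_hessianOp hf).norm.tendsto.mono_left nhdsWithin_le_nhds) ?_
  filter_upwards [self_mem_nhdsWithin] with y hy
  exact norm_fderiv_le_of_lipschitzOn ℝ (mem_interior_iff_mem_nhds.mp hy) hL

theorem inv_mem_spectrum_of_det_id_sub_smul_eq_zero {E : Type*} [NormedAddCommGroup E]
    [NormedSpace ℝ E] [FiniteDimensional ℝ E] {H : E →L[ℝ] E} {α : ℝ} (hα : α ≠ 0)
    (hdet : (ContinuousLinearMap.id ℝ E - α • H).det = 0) : α⁻¹ ∈ spectrum ℝ H := by
  rw [spectrum.mem_iff]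
  intro hu
  have h1 : ContinuousLinearMap.id ℝ E - α • H
      = α • (algebraMap ℝ (E →L[ℝ] E) α⁻¹ - H) := by
    rw [smul_sub, Algebra.algebraMap_eq_smul_one, smul_smul, mul_inv_cancel₀ hα, one_smul]
    rfl
  have h2 : IsUnit (ContinuousLinearMap.id ℝ E - α • H) := by
    rw [h1]
    exact hu.smul (Units.mk0 α hα)
  have h3 := LinearMap.isUnit_det _ (ContinuousLinearMap.isUnit_iff_isUnit_toLinearMap.mp h2)
  exact h3.ne_zero hdet

end GradientDescent

theorem mainTheorem1 {d : ℕ} (f : EuclideanSpace ℝ (Fin d) → ℝ)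
    (U Ω : Set (EuclideanSpace ℝ (Fin d))) (L : NNReal) (α : ℝ)
    (hU : IsOpen U) (hΩU : Ω ⊆ U) (hf : ContDiffOn ℝ 2 f U)
    (hconv : Convex ℝ Ω)
    (hinv : Set.MapsTo (gdMap f α) Ω Ω)
    (hL : LipschitzOnWith L (gradient f) Ω)
    (hα : α * (L : ℝ) ∈ Set.Ioo (0 : ℝ) 2)
    (hnull : volume (degenerateSet f α Ω) = 0)
    (hsaddle : ∀ x ∈ degenerateSet f α Ω, ¬ IsSaddlePoint f x) :
    volume {x₀ : EuclideanSpace ℝ (Fin d) | x₀ ∈ Ω ∧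
      ∃ xs ∈ U, IsStrictSaddle f xs ∧
        Tendsto (fun n : ℕ => (gdMap f α)^[n] x₀) atTop (𝓝 xs)} = 0 := by
  have hα0 : 0 < α := pos_of_mul_pos_left hα.1 L.coe_nonneg
  have hfU : ∀ x ∈ U, ContDiffAt ℝ 2 f x := fun x hx => hf.contDiffAt (hU.mem_nhds hx)
  rcases (interior Ω).eq_empty_or_nonempty with hint | hint
  · -- A convex set without interior lies in its frontier, which is null.
    refine measure_mono_null (fun x hx => ?_) (hconv.addHaar_frontier volume)
    exact ⟨subset_closure hx.1, hint ▸ Set.notMem_empty x⟩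
  have hpre : ∀ N, volume N = 0 → volume (Ω ∩ gdMap f α ⁻¹' N) = 0 := fun N hN =>
    addHaar_inter_preimage_eq_zero volume
      (fun x hx => hasStrictFDerivAt_gdMap (hfU x (hΩU hx)) α)
      (measure_mono_null (t := degenerateSet f α Ω) (fun x hx => ⟨hx.1,
        inv_mem_spectrum_of_det_id_sub_smul_eq_zero hα0.ne' hx.2⟩) hnull) hN
  refine measure_mono_null ?_ (measure_setOf_tendsto_eq_zero
    (P := {p | p ∈ U ∧ p ∈ closure Ω ∧ IsStrictSaddle f p}) hinv hpre ?_)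
  · rintro x ⟨hx, p, hpU, hp, hlim⟩
    exact ⟨hx, p, ⟨hpU, mem_closure_of_tendsto hlim
      (Eventually.of_forall fun n => hinv.iterate n hx), hp⟩, hlim⟩
  · rintro p ⟨hpU, hpΩ, -, m, hm, heig⟩
    rw [← hconv.closure_interior_eq_closure_of_nonempty_interior hint] at hpΩ
    exact exists_nhds_addHaar_trapped_eq_zero volume (hessianOp f p)
      (hessianOp_symmetric (hfU p hpU)) hα0
      (norm_hessianOp_le_of_mem_closure hL (hfU p hpU) hpΩ) hα.2 hm heig
      (hasStrictFDerivAt_gdMap (hfU p hpU) α)
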